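/- Proposition (Uniform fully quadratic constants). Let $n\ge 0$, $f:\mathbb{R}^n\to\mathbb{R}$, points $x_k\in\mathbb{R}^n$, radii $\Delta_k>0$ and symmetric matrices $M_k\in\mathbb{R}^{n\times n}$ ($k=0,1,2,\dots$) be given with $$m_{\min}I\preceq M_k\preceq m_{\max}I\quad\text{for all }k,\qquad 0<m_{\min}\le m_{\max}<\infty .$$ Let $M_k^{1/2}$ be the symmetric positive definite square root, and let $\mathcal R\subset\mathbb{R}^n$ be a set containing all the points $x_k+M_k^{-1/2}y$ with $\|y\|\le\Delta_k$, $k\ge0$. Suppose that $f$ is twice differentiable at every point of $\mathcal R$ (that is, differentiable in a neighbourhood of the point, with gradient differentiable at the point) and that its Hessian is $L_2$-Lipschitz on $\mathcal R$, $\|\nabla^2f(u)-\nabla^2f(v)\|_2\le L_2\|u-v\|$ for $u,v\in\mathcal R$, where $L_2\ge0$. Put $\widetilde f_k(y)=f(x_k+M_k^{-1/2}y)$. (i) For every $k$, $\widetilde f_k$ is twice differentiable (in the same sense) at every point of the ball $\{\|y\|\le\Delta_k\}$, and its Hessian is Lipschitz on this ball with constant $L_2m_{\min}^{-3/2}$.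 (ii) Let $q_n=(n+1)(n+2)/2$ and $\Lambda\in\mathbb{R}$, and for each $k$ let $Y_k=(Y_k^{(0)},\dots,Y_k^{(q_n-1)})$ be points of $\{x_k+s:(s^\top M_ks)^{1/2}\le\Delta_k\}$ whose images $\widetilde Y_k^{(i)}=M_k^{1/2}(Y_k^{(i)}-x_k)$ are $\Lambda$-poised in $\{\|y\|\le\Delta_k\}$ for quadratic interpolation: every interpolation problem at the points $\widetilde Y_k^{(i)}$ has exactly one solution among polynomials of degree at most $2$, and each Lagrange polynomial $\ell$ of these points satisfies $|\ell(y)|\le\Lambda$ for $\|y\|\le\Delta_k$. Let $\widetilde m_k(y)=c_k+g_k^\top y+\tfrac12y^\top B_ky$, with $B_k$ symmetric, be the quadratic polynomial that interpolates $\widetilde f_k$ at the points $\widetilde Y_k^{(i)}$. Then there are constants $\kappa_f,\kappa_g,\kappa_H$, depending only on $n$, $\Lambda$ and $L_2m_{\min}^{-3/2}$ (in particular not on $k$), such that for all $k$ and all $\|y\|\le\Delta_k$ $$|\widetilde f_k(y)-\widetilde m_k(y)|\le\kappa_f\Delta_k^3,\qquad \|\nabla\widetilde f_k(y)-\nabla\widetilde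 m_k(y)\|\le\kappa_g\Delta_k^2,\qquad \|\nabla^2\widetilde f_k(y)-B_k\|_2\le\kappa_H\Delta_k .$$ -/

import Mathlib

open scoped Matrix

noncomputable section

/-- The Hessian `∇² f (x)`, as a linear operator on `ℝⁿ`: the derivative of the gradient.
The operator norm on `E n →L[ℝ] E n` is the spectral norm `‖·‖₂`. -/
def hess {n : ℕ} (f : EuclideanSpace ℝ (Fin n) → ℝ) (x : EuclideanSpace ℝ (Fin n)) :
    EuclideanSpace ℝ (Fin n) →L[ℝ] EuclideanSpace ℝ (Fin n) :=
  fderiv ℝ (gradient f) x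

/-- `f` is twice differentiable at `x`: differentiable near `x`, with gradient differentiable
at `x`. -/
def TwiceDifferentiableAt {n : ℕ} (f : EuclideanSpace ℝ (Fin n) → ℝ)
    (x : EuclideanSpace ℝ (Fin n)) : Prop :=
  (∀ᶠ z in nhds x, DifferentiableAt ℝ f z) ∧ DifferentiableAt ℝ (gradient f) x

/-- `f` has an `L`-Lipschitz Hessian on `S`. -/
def HasLipschitzHessianOn {n : ℕ} (f : EuclideanSpace ℝ (Fin n) → ℝ)
    (S : Set (EuclideanSpace ℝ (Fin n))) (L : ℝ) : Prop :=
  (∀ x ∈ S, TwiceDifferentiableAt f x) ∧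
    ∀ x ∈ S, ∀ z ∈ S, ‖hess f x - hess f z‖ ≤ L * ‖x - z‖

open scoped MatrixOrder in
/-- The symmetric positive (semi)definite square root `T = M^{1/2}`. -/
def metricRoot {n : ℕ} (M : Matrix (Fin n) (Fin n) ℝ) : Matrix (Fin n) (Fin n) ℝ :=
  CFC.sqrt M

/-- The induced coordinate `M^{1/2} s` of a step `s`. -/
def toInduced {n : ℕ} (M : Matrix (Fin n) (Fin n) ℝ) (s : EuclideanSpace ℝ (Fin n)) :
    EuclideanSpace ℝ (Fin n) :=
  Matrix.toEuclideanCLM (𝕜 := ℝ) (metricRoot M) s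

/-- The step `M^{-1/2} y` with induced coordinate `y`. -/
def fromInduced {n : ℕ} (M : Matrix (Fin n) (Fin n) ℝ) (y : EuclideanSpace ℝ (Fin n)) :
    EuclideanSpace ℝ (Fin n) :=
  Matrix.toEuclideanCLM (𝕜 := ℝ) (metricRoot M)⁻¹ y

/-- The induced function `y ↦ f (x + M^{-1/2} y)`. -/
def inducedFun {n : ℕ} (f : EuclideanSpace ℝ (Fin n) → ℝ) (x : EuclideanSpace ℝ (Fin n))
    (M : Matrix (Fin n) (Fin n) ℝ) (y : EuclideanSpace ℝ (Fin n)) : ℝ :=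
  f (x + fromInduced M y)

/-- The metric ball `{x + s : (sᵀ M s)^{1/2} ≤ Δ}`. -/
def metricBall {n : ℕ} (M : Matrix (Fin n) (Fin n) ℝ) (x : EuclideanSpace ℝ (Fin n)) (Δ : ℝ) :
    Set (EuclideanSpace ℝ (Fin n)) :=
  {z | Real.sqrt ((z - x).ofLp ⬝ᵥ (M *ᵥ (z - x).ofLp)) ≤ Δ}

/-- A quadratic polynomial `c + gᵀ y + ½ yᵀ B y` on `ℝⁿ`, given by its coefficients
(`B` symmetric). -/
structure QuadModel (n : ℕ) where
  c : ℝ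
  g : EuclideanSpace ℝ (Fin n)
  B : Matrix (Fin n) (Fin n) ℝ
  symm : B.IsSymm

/-- The value `c + gᵀ y + ½ yᵀ B y`. -/
def QuadModel.eval {n : ℕ} (m : QuadModel n) (y : EuclideanSpace ℝ (Fin n)) : ℝ :=
  m.c + m.g.ofLp ⬝ᵥ y.ofLp + (1 / 2) * (y.ofLp ⬝ᵥ (m.B *ᵥ y.ofLp))

/-- The dimension `q_n = (n+1)(n+2)/2` of the space of quadratic polynomials on `ℝⁿ`. -/
def quadDim (n : ℕ) : ℕ := (n + 1) * (n + 2) / 2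

/-- `Y` is poised for quadratic interpolation: every interpolation problem on `Y` has exactly
one solution. -/
def IsPoised {n : ℕ} (Y : Fin (quadDim n) → EuclideanSpace ℝ (Fin n)) : Prop :=
  ∀ v : Fin (quadDim n) → ℝ, ∃! p : QuadModel n, ∀ i, p.eval (Y i) = v i

/-- `Y` is `Λ`-poised in the Euclidean ball `{‖y‖ ≤ Δ}` for quadratic interpolation: it is
poised and its Lagrange polynomials are bounded by `Λ` in absolute value on the ball. -/
def IsLambdaPoised {n : ℕ} (Λ Δ : ℝ) (Y : Fin (quadDim n) → EuclideanSpace ℝ (Fin n)) : Prop :=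
  IsPoised Y ∧ ∀ (i : Fin (quadDim n)) (l : QuadModel n),
    (∀ j, l.eval (Y j) = if j = i then 1 else 0) → ∀ y, ‖y‖ ≤ Δ → |l.eval y| ≤ Λ

/-- `Y` is `Λ`-poised in the metric ball of `M` at `x` with radius `Δ`: it lies in that ball, and
its image in induced coordinates is `Λ`-poised in the Euclidean ball of radius `Δ`. -/
def IsMetricPoised {n : ℕ} (Λ : ℝ) (M : Matrix (Fin n) (Fin n) ℝ)
    (x : EuclideanSpace ℝ (Fin n)) (Δ : ℝ)
    (Y : Fin (quadDim n) → EuclideanSpace ℝ (Fin n)) : Prop :=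
  (∀ i, Y i ∈ metricBall M x Δ) ∧ IsLambdaPoised Λ Δ (fun i => toInduced M (Y i - x))

/-- The quadratic `m` interpolates `F` at the points of `Y`. -/
def Interpolates {n : ℕ} (m : QuadModel n) (F : EuclideanSpace ℝ (Fin n) → ℝ)
    (Y : Fin (quadDim n) → EuclideanSpace ℝ (Fin n)) : Prop :=
  ∀ i, m.eval (Y i) = F (Y i)

/-- `m` is a fully quadratic model of `F` on `{‖y‖ ≤ Δ}` with constants `κf, κg, κH`. -/
def IsFullyQuadratic {n : ℕ} (F : EuclideanSpace ℝ (Fin n) → ℝ) (m : QuadModel n)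
    (Δ κf κg κH : ℝ) : Prop :=
  ∀ y, ‖y‖ ≤ Δ →
    |F y - m.eval y| ≤ κf * Δ ^ 3 ∧
    ‖gradient F y - gradient m.eval y‖ ≤ κg * Δ ^ 2 ∧
    ‖hess F y - Matrix.toEuclideanCLM (𝕜 := ℝ) m.B‖ ≤ κH * Δ

end

variable {n : ℕ}

/-! ### The matrix square root -/

theorem sq_norm_toInduced {M : Matrix (Fin n) (Fin n) ℝ} (hM : M.PosSemidef)
    (s : EuclideanSpace ℝ (Fin n)) : ‖toInduced M s‖ ^ 2 = s.ofLp ⬝ᵥ (M *ᵥ s.ofLp) := by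
  open scoped MatrixOrder in
  have hS : (metricRoot M).PosSemidef := Matrix.nonneg_iff_posSemidef.1 (CFC.sqrt_nonneg M)
  open scoped MatrixOrder in
  have hmul : metricRoot M * metricRoot M = M := CFC.sqrt_mul_sqrt_self M hM.nonneg
  have hT : (metricRoot M)ᵀ = metricRoot M := by simpa using hS.isHermitian.eq
  rw [← real_inner_self_eq_norm_sq]
  unfold toInduced
  rw [Matrix.inner_toEuclideanCLM, Matrix.ofLp_toEuclideanCLM]
  conv_rhs => rw [← hmul]
  rw [← Matrix.mulVec_mulVec, Matrix.dotProduct_mulVec s.ofLp, ← Matrix.mulVec_transpose, hT]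

theorem isUnit_metricRoot {M : Matrix (Fin n) (Fin n) ℝ} (hM : M.PosDef) :
    IsUnit (metricRoot M) := by
  open scoped MatrixOrder in
  have hmul : metricRoot M * metricRoot M = M :=
    CFC.sqrt_mul_sqrt_self M hM.posSemidef.nonneg
  exact isUnit_of_mul_isUnit_left (hmul ▸ hM.isUnit)

theorem toInduced_fromInduced {M : Matrix (Fin n) (Fin n) ℝ} (hM : M.PosDef)
    (y : EuclideanSpace ℝ (Fin n)) : toInduced M (fromInduced M y) = y := by
  have h : metricRoot M * (metricRoot M)⁻¹ = 1 :=
    Matrix.mul_nonsing_inv _ ((Matrix.isUnit_iff_isUnit_det _).1 (isUnit_metricRoot hM))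
  have h2 := map_mul (Matrix.toEuclideanCLM (n := Fin n) (𝕜 := ℝ)) (metricRoot M) (metricRoot M)⁻¹
  rw [h, map_one] at h2
  exact (DFunLike.congr_fun h2 y).symm

theorem posDef_of_sub_smul_one {M : Matrix (Fin n) (Fin n) ℝ} {c : ℝ} (hc : 0 < c)
    (h : (M - c • (1 : Matrix (Fin n) (Fin n) ℝ)).PosSemidef) : M.PosDef := by
  have := (Matrix.PosDef.one (n := Fin n) (R := ℝ)).smul hc |>.add_posSemidef h
  simpa using this

theorem mul_sq_norm_le_of_sub_smul_one {M : Matrix (Fin n) (Fin n) ℝ} {c : ℝ}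
    (h : (M - c • (1 : Matrix (Fin n) (Fin n) ℝ)).PosSemidef) (s : EuclideanSpace ℝ (Fin n)) :
    c * ‖s‖ ^ 2 ≤ s.ofLp ⬝ᵥ (M *ᵥ s.ofLp) := by
  have h1 := h.dotProduct_mulVec_nonneg s.ofLp
  have h2 : ‖s‖ ^ 2 = s.ofLp ⬝ᵥ s.ofLp := by
    rw [← real_inner_self_eq_norm_sq, EuclideanSpace.inner_eq_star_dotProduct, star_trivial]
  rw [star_trivial, Matrix.sub_mulVec, dotProduct_sub, Matrix.smul_mulVec, Matrix.one_mulVec,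
    dotProduct_smul, smul_eq_mul] at h1
  rw [h2]
  linarith

theorem norm_toEuclideanCLM_inv_metricRoot_le {M : Matrix (Fin n) (Fin n) ℝ} {c : ℝ} (hc : 0 < c)
    (h : (M - c • (1 : Matrix (Fin n) (Fin n) ℝ)).PosSemidef) :
    ‖Matrix.toEuclideanCLM (𝕜 := ℝ) (metricRoot M)⁻¹‖ ≤ c ^ (-(1 / 2) : ℝ) := by
  have hM := posDef_of_sub_smul_one hc h
  have hp : (0 : ℝ) < c ^ (1 / 2 : ℝ) := Real.rpow_pos_of_pos hc _
  have hsq : (c ^ (1 / 2 : ℝ)) ^ 2 = c := by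
    rw [← Real.rpow_natCast, ← Real.rpow_mul hc.le]; norm_num
  rw [Real.rpow_neg hc.le]
  refine ContinuousLinearMap.opNorm_le_bound _ (inv_nonneg.2 hp.le) fun y => ?_
  have h1 := mul_sq_norm_le_of_sub_smul_one h (fromInduced M y)
  rw [← sq_norm_toInduced hM.posSemidef, toInduced_fromInduced hM] at h1
  have h2 : c ^ (1 / 2 : ℝ) * ‖fromInduced M y‖ ≤ ‖y‖ := by
    refine le_of_sq_le_sq ?_ (norm_nonneg y)
    rw [mul_pow, hsq]
    exact h1
  rw [inv_mul_eq_div, le_div_iff₀ hp, mul_comm]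
  exact h2

/-! ### Gradient and Hessian under an affine substitution -/

theorem hasGradientAt_comp_add_clm {f : EuclideanSpace ℝ (Fin n) → ℝ}
    (T : EuclideanSpace ℝ (Fin n) →L[ℝ] EuclideanSpace ℝ (Fin n)) (x y : EuclideanSpace ℝ (Fin n))
    (hf : DifferentiableAt ℝ f (x + T y)) :
    HasGradientAt (fun z => f (x + T z)) (T.adjoint (gradient f (x + T y))) y := by
  rw [hasGradientAt_iff_hasFDerivAt]
  have h1 : HasFDerivAt (fun z => x + T z) T y := T.hasFDerivAt.const_add x
  have h2 := hf.hasGradientAt.hasFDerivAt.comp y h1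
  refine h2.congr_fderiv (ContinuousLinearMap.ext fun v => ?_)
  exact (ContinuousLinearMap.adjoint_inner_left T v _).symm

theorem TwiceDifferentiableAt.hasFDerivAt_gradient {f : EuclideanSpace ℝ (Fin n) → ℝ}
    {x : EuclideanSpace ℝ (Fin n)} (hf : TwiceDifferentiableAt f x) :
    HasFDerivAt (gradient f) (hess f x) x := hf.2.hasFDerivAt

theorem TwiceDifferentiableAt.comp_add_clm {f : EuclideanSpace ℝ (Fin n) → ℝ}
    (T : EuclideanSpace ℝ (Fin n) →L[ℝ] EuclideanSpace ℝ (Fin n)) (x y : EuclideanSpace ℝ (Fin n))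
    (hf : TwiceDifferentiableAt f (x + T y)) :
    TwiceDifferentiableAt (fun z => f (x + T z)) y ∧
      hess (fun z => f (x + T z)) y = T.adjoint ∘L hess f (x + T y) ∘L T := by
  have h1 : HasFDerivAt (fun z => x + T z) T y := T.hasFDerivAt.const_add x
  have hev := h1.continuousAt.eventually hf.1
  have hg : gradient (fun z => f (x + T z)) =ᶠ[nhds y]
      fun z => T.adjoint (gradient f (x + T z)) := by
    filter_upwards [hev] with z hz using (hasGradientAt_comp_add_clm T x z hz).gradient
  have hd : HasFDerivAt (gradient (fun z => f (x + T z)))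
      (T.adjoint ∘L hess f (x + T y) ∘L T) y := by
    have h2 : HasFDerivAt (fun z => gradient f (x + T z)) (hess f (x + T y) ∘L T) y :=
      HasFDerivAt.comp (g := gradient f) (f := fun z => x + T z) y hf.hasFDerivAt_gradient h1
    have h3 : HasFDerivAt (fun z => T.adjoint (gradient f (x + T z)))
      (T.adjoint ∘L hess f (x + T y) ∘L T) y := T.adjoint.hasFDerivAt.comp y h2
    exact h3.congr_of_eventuallyEq hg
  refine ⟨⟨?_, hd.differentiableAt⟩, hd.fderiv⟩
  filter_upwards [hev] with z hz using (hasGradientAt_comp_add_clm T x z hz).differentiableAt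

theorem hasLipschitzHessianOn_inducedFun {f : EuclideanSpace ℝ (Fin n) → ℝ}
    {R : Set (EuclideanSpace ℝ (Fin n))} {L c Δ : ℝ} {x : EuclideanSpace ℝ (Fin n)}
    {M : Matrix (Fin n) (Fin n) ℝ} (hL : 0 ≤ L) (hc : 0 < c)
    (hM : (M - c • (1 : Matrix (Fin n) (Fin n) ℝ)).PosSemidef)
    (hR : ∀ y, ‖y‖ ≤ Δ → x + fromInduced M y ∈ R) (hf : HasLipschitzHessianOn f R L) :
    HasLipschitzHessianOn (inducedFun f x M) {y | ‖y‖ ≤ Δ} (L * c ^ (-(3 / 2) : ℝ)) := by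
  set T := Matrix.toEuclideanCLM (n := Fin n) (𝕜 := ℝ) (metricRoot M)⁻¹ with hT
  have hF : inducedFun f x M = fun z => f (x + T z) := rfl
  have hTn : ‖T‖ ≤ c ^ (-(1 / 2) : ℝ) := norm_toEuclideanCLM_inv_metricRoot_le hc hM
  have hcomp : ∀ y, ‖y‖ ≤ Δ → _ := fun y hy =>
    (hf.1 _ (hR y hy)).comp_add_clm T x y
  rw [hF]
  refine ⟨fun y hy => (hcomp y hy).1, fun y hy z hz => ?_⟩
  rw [(hcomp y hy).2, (hcomp z hz).2]
  have e : T.adjoint ∘L hess f (x + T y) ∘L T - T.adjoint ∘L hess f (x + T z) ∘L T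
      = T.adjoint ∘L (hess f (x + T y) - hess f (x + T z)) ∘L T := by
    ext1 v; simp
  rw [e]
  have hlip : ‖hess f (x + T y) - hess f (x + T z)‖ ≤ L * (‖T‖ * ‖y - z‖) := by
    refine (hf.2 _ (hR y hy) _ (hR z hz)).trans (mul_le_mul_of_nonneg_left ?_ hL)
    have : x + fromInduced M y - (x + fromInduced M z) = T (y - z) := by
      rw [map_sub, add_sub_add_left_eq_sub]; rfl
    rw [this]
    exact T.le_opNorm _
  have hpow : c ^ (-(3 / 2) : ℝ) = (c ^ (-(1 / 2) : ℝ)) ^ 3 := by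
    rw [← Real.rpow_natCast, ← Real.rpow_mul hc.le]; norm_num
  calc ‖T.adjoint ∘L (hess f (x + T y) - hess f (x + T z)) ∘L T‖
      ≤ ‖T.adjoint‖ * (‖hess f (x + T y) - hess f (x + T z)‖ * ‖T‖) :=
        (ContinuousLinearMap.opNorm_comp_le _ _).trans
          (mul_le_mul_of_nonneg_left (ContinuousLinearMap.opNorm_comp_le _ _) (norm_nonneg _))
    _ ≤ ‖T‖ * (L * (‖T‖ * ‖y - z‖) * ‖T‖) := by
        rw [LinearIsometryEquiv.norm_map]
        gcongr
    _ = L * ‖T‖ ^ 3 * ‖y - z‖ := by ring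
    _ ≤ L * c ^ (-(3 / 2) : ℝ) * ‖y - z‖ := by
        rw [hpow]
        gcongr

/-! ### Symmetry of the Hessian -/

theorem TwiceDifferentiableAt.hess_isSymmetric {f : EuclideanSpace ℝ (Fin n) → ℝ}
    {x : EuclideanSpace ℝ (Fin n)} (hf : TwiceDifferentiableAt f x)
    (v w : EuclideanSpace ℝ (Fin n)) : inner ℝ (hess f x v) w = inner ℝ v (hess f x w) := by
  have h1 : ∀ᶠ z in nhds x, HasFDerivAt f (innerSL ℝ (gradient f z)) z := by
    filter_upwards [hf.1] with z hz using hz.hasGradientAt.hasFDerivAt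
  have h2 := (innerSL ℝ (E := EuclideanSpace ℝ (Fin n))).hasFDerivAt.comp x hf.hasFDerivAt_gradient
  have := second_derivative_symmetric_of_eventually h1 h2 v w
  rw [← real_inner_comm v]
  exact this

/-! ### Quadratic models -/

namespace QuadModel

theorem eval_eq_inner (m : QuadModel n) (y : EuclideanSpace ℝ (Fin n)) :
    m.eval y = m.c + inner ℝ m.g y
      + (1 / 2) * inner ℝ y (Matrix.toEuclideanCLM (𝕜 := ℝ) m.B y) := by
  rw [Matrix.inner_toEuclideanCLM, EuclideanSpace.inner_eq_star_dotProduct, star_trivial,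
    dotProduct_comm]
  rfl

theorem isSymmetric_toEuclideanCLM (m : QuadModel n) (v w : EuclideanSpace ℝ (Fin n)) :
    inner ℝ (Matrix.toEuclideanCLM (𝕜 := ℝ) m.B v) w
      = inner ℝ v (Matrix.toEuclideanCLM (𝕜 := ℝ) m.B w) := by
  rw [real_inner_comm, Matrix.inner_toEuclideanCLM, Matrix.inner_toEuclideanCLM,
    Matrix.dotProduct_mulVec, ← Matrix.mulVec_transpose, m.symm.eq, dotProduct_comm]

theorem hasGradientAt_eval (m : QuadModel n) (y : EuclideanSpace ℝ (Fin n)) :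
    HasGradientAt m.eval (m.g + Matrix.toEuclideanCLM (𝕜 := ℝ) m.B y) y := by
  rw [hasGradientAt_iff_hasFDerivAt]
  set T := Matrix.toEuclideanCLM (n := Fin n) (𝕜 := ℝ) m.B with hT
  have h : m.eval = fun z => m.c + inner ℝ m.g z + (1 / 2) * inner ℝ z (T z) :=
    funext m.eval_eq_inner
  rw [h]
  have h1 : HasFDerivAt (fun z : EuclideanSpace ℝ (Fin n) => inner ℝ m.g z)
      (innerSL ℝ m.g) y := (innerSL ℝ m.g).hasFDerivAt
  have h2 := (hasFDerivAt_id (𝕜 := ℝ) y).inner ℝ T.hasFDerivAt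
  refine ((h1.const_add m.c).add (h2.const_mul (1 / 2))).congr_fderiv
    (ContinuousLinearMap.ext fun v => ?_)
  change inner ℝ m.g v + (1 / 2) * (inner ℝ y (T v) + inner ℝ v (T y)) = inner ℝ (m.g + T y) v
  rw [inner_add_left, real_inner_comm (T y) v, m.isSymmetric_toEuclideanCLM y v]
  ring

/-- The difference of two quadratic models. -/
def sub (p q : QuadModel n) : QuadModel n :=
  ⟨p.c - q.c, p.g - q.g, p.B - q.B, p.symm.sub q.symm⟩

theorem eval_sub (p q : QuadModel n) (y : EuclideanSpace ℝ (Fin n)) :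
    (p.sub q).eval y = p.eval y - q.eval y := by
  simp only [eval_eq_inner, sub, map_sub, inner_sub_left, inner_sub_right, sub_apply]
  ring

/-- A linear combination of quadratic models. -/
def linComb {ι : Type*} [Fintype ι] (v : ι → ℝ) (p : ι → QuadModel n) : QuadModel n :=
  ⟨∑ i, v i * (p i).c, ∑ i, v i • (p i).g, ∑ i, v i • (p i).B, by
    simp only [Matrix.IsSymm, Matrix.transpose_sum, Matrix.transpose_smul, (p _).symm.eq]⟩

theorem eval_linComb {ι : Type*} [Fintype ι] (v : ι → ℝ) (p : ι → QuadModel n)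
    (y : EuclideanSpace ℝ (Fin n)) : (linComb v p).eval y = ∑ i, v i * (p i).eval y := by
  simp only [eval_eq_inner, linComb, map_sum, map_smul, sum_inner, inner_sum,
    sum_apply, smul_apply, inner_smul_left,
    inner_smul_right, RCLike.conj_to_real, mul_add, Finset.sum_add_distrib, Finset.mul_sum]
  congr 1
  exact Finset.sum_congr rfl fun i _ => by ring

theorem norm_g_mul_le {q : QuadModel n} {A Δ : ℝ} (hΔ : 0 < Δ)
    (h : ∀ y, ‖y‖ ≤ Δ → |q.eval y| ≤ A) : ‖q.g‖ * Δ ≤ A := by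
  have hA : 0 ≤ A := (abs_nonneg _).trans (h 0 (by simpa using hΔ.le))
  rcases eq_or_ne q.g 0 with h0 | h0
  · simpa [h0] using hA
  have hg : 0 < ‖q.g‖ := norm_pos_iff.2 h0
  set y := (Δ / ‖q.g‖) • q.g with hy
  have hn : ‖y‖ = Δ := by
    rw [hy, norm_smul, Real.norm_of_nonneg (by positivity), div_mul_cancel₀ _ hg.ne']
  have hi : inner ℝ q.g y = ‖q.g‖ * Δ := by
    rw [hy, inner_smul_right, real_inner_self_eq_norm_sq]; field_simp
  have h1 := abs_le.1 (h y hn.le)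
  have h2 := abs_le.1 (h (-y) (by rw [norm_neg, hn]))
  simp only [eval_eq_inner, inner_neg_right, inner_neg_left, map_neg, neg_neg, hi] at h1 h2
  linarith [h1.2, h2.1]

theorem norm_B_mul_le {q : QuadModel n} {A Δ : ℝ} (hΔ : 0 < Δ)
    (h : ∀ y, ‖y‖ ≤ Δ → |q.eval y| ≤ A) :
    ‖Matrix.toEuclideanCLM (𝕜 := ℝ) q.B‖ * Δ ^ 2 ≤ 4 * A := by
  set T := Matrix.toEuclideanCLM (n := Fin n) (𝕜 := ℝ) q.B with hT
  have hc : |q.c| ≤ A := by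
    simpa [eval_eq_inner] using h 0 (by simpa using hΔ.le)
  have hA : 0 ≤ A := (abs_nonneg _).trans hc
  have hball : ∀ y, ‖y‖ ≤ Δ → |inner ℝ y (T y)| ≤ 4 * A := by
    intro y hy
    have h1 := abs_le.1 (h y hy)
    have h2 := abs_le.1 (h (-y) (by rwa [norm_neg]))
    have h3 := abs_le.1 hc
    simp only [eval_eq_inner, inner_neg_right, inner_neg_left, map_neg, neg_neg, ← hT] at h1 h2
    exact abs_le.2 ⟨by linarith [h1.1, h2.1, h3.2], by linarith [h1.2, h2.2, h3.1]⟩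
  rw [← le_div_iff₀ (by positivity),
    T.norm_eq_iSup_rayleighQuotient (fun v w => q.isSymmetric_toEuclideanCLM v w)]
  refine ciSup_le fun x => ?_
  rcases eq_or_ne x 0 with rfl | hx
  · simp only [ContinuousLinearMap.rayleighQuotient_apply_zero, abs_zero]; positivity
  have hx' : 0 < ‖x‖ := norm_pos_iff.2 hx
  have h1 := hball ((Δ / ‖x‖) • x)
    (by rw [norm_smul, Real.norm_of_nonneg (by positivity), div_mul_cancel₀ _ hx'.ne'])
  rw [map_smul, inner_smul_left, inner_smul_right, RCLike.conj_to_real, ← mul_assoc, abs_mul,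
    abs_of_nonneg (by positivity)] at h1
  have h2 : T.rayleighQuotient x = inner ℝ x (T x) / ‖x‖ ^ 2 := by
    rw [ContinuousLinearMap.rayleighQuotient, ContinuousLinearMap.reApplyInnerSelf_apply,
      RCLike.re_to_real, real_inner_comm]
  rw [h2, abs_div, abs_of_nonneg (by positivity : 0 ≤ ‖x‖ ^ 2), le_div_iff₀ (by positivity)]
  calc |inner ℝ x (T x)| / ‖x‖ ^ 2 * Δ ^ 2
      = Δ / ‖x‖ * (Δ / ‖x‖) * |inner ℝ x (T x)| := by field_simp
    _ ≤ 4 * A := h1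

end QuadModel

theorem IsLambdaPoised.abs_eval_le {Λ Δ ε : ℝ}
    {Y : Fin (quadDim n) → EuclideanSpace ℝ (Fin n)} (hY : IsLambdaPoised Λ Δ Y) {q : QuadModel n}
    (hε : 0 ≤ ε) (hq : ∀ i, |q.eval (Y i)| ≤ ε) {y : EuclideanSpace ℝ (Fin n)} (hy : ‖y‖ ≤ Δ) :
    |q.eval y| ≤ quadDim n * (ε * Λ) := by
  choose l hl _ using fun i => hY.1 (fun j => if j = i then (1 : ℝ) else 0)
  have hq' : q = QuadModel.linComb (fun i => q.eval (Y i)) l := by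
    refine (hY.1 fun i => q.eval (Y i)).unique (fun i => rfl) fun i => ?_
    rw [QuadModel.eval_linComb]
    simp [show ∀ j, (l j).eval (Y i) = if i = j then (1 : ℝ) else 0 from fun j => hl j i]
  rw [hq', QuadModel.eval_linComb]
  refine (Finset.abs_sum_le_sum_abs _ _).trans ?_
  refine (Finset.sum_le_sum (g := fun _ => ε * Λ) fun i _ => ?_).trans (by simp)
  rw [abs_mul]
  exact mul_le_mul (hq i) (hY.2 i (l i) (hl i) y hy) (abs_nonneg _) hε

/-! ### Taylor expansion -/

/-- The second-order Taylor model of `F` at the origin. -/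
noncomputable def taylorModel {F : EuclideanSpace ℝ (Fin n) → ℝ} (hF : TwiceDifferentiableAt F 0) :
    QuadModel n :=
  ⟨F 0, gradient F 0, (Matrix.toEuclideanCLM (n := Fin n) (𝕜 := ℝ)).symm (hess F 0), by
    refine Matrix.IsSymm.ext fun i j => ?_
    have h := hF.hess_isSymmetric (EuclideanSpace.single i 1) (EuclideanSpace.single j 1)
    rw [← (Matrix.toEuclideanCLM (n := Fin n) (𝕜 := ℝ)).apply_symm_apply (hess F 0), real_inner_comm, Matrix.inner_toEuclideanCLM, Matrix.inner_toEuclideanCLM] at h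
    simpa using h⟩

theorem toEuclideanCLM_taylorModel_B {F : EuclideanSpace ℝ (Fin n) → ℝ}
    (hF : TwiceDifferentiableAt F 0) :
    Matrix.toEuclideanCLM (𝕜 := ℝ) (taylorModel hF).B = hess F 0 :=
  (Matrix.toEuclideanCLM (n := Fin n) (𝕜 := ℝ)).apply_symm_apply _

theorem isFullyQuadratic_taylorModel {F : EuclideanSpace ℝ (Fin n) → ℝ} {L Δ : ℝ} (hL : 0 ≤ L)
    (hΔ : 0 < Δ) (hF : HasLipschitzHessianOn F {y | ‖y‖ ≤ Δ} L) (h0 : TwiceDifferentiableAt F 0) :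
    IsFullyQuadratic F (taylorModel h0) Δ L L L := by
  have hmem : (0 : EuclideanSpace ℝ (Fin n)) ∈ {y | ‖y‖ ≤ Δ} := by simpa using hΔ.le
  have hconv : Convex ℝ {y : EuclideanSpace ℝ (Fin n) | ‖y‖ ≤ Δ} := by
    simpa [Metric.closedBall, dist_zero_right] using
      convex_closedBall (0 : EuclideanSpace ℝ (Fin n)) Δ
  have hH : ∀ y ∈ {y : EuclideanSpace ℝ (Fin n) | ‖y‖ ≤ Δ}, ‖hess F y - hess F 0‖ ≤ L * Δ := by
    intro y hy
    refine (hF.2 y hy 0 hmem).trans ?_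
    rw [sub_zero]
    exact mul_le_mul_of_nonneg_left hy hL
  have hG : ∀ y ∈ {y : EuclideanSpace ℝ (Fin n) | ‖y‖ ≤ Δ},
      ‖gradient F y - gradient (taylorModel h0).eval y‖ ≤ L * Δ ^ 2 := by
    intro y hy
    have h1 := hconv.norm_image_sub_le_of_norm_hasFDerivWithin_le'
      (fun z hz => (hF.1 z hz).hasFDerivAt_gradient.hasFDerivWithinAt) hH hmem hy
    rw [((taylorModel h0).hasGradientAt_eval y).gradient, toEuclideanCLM_taylorModel_B, ← sub_sub]
    rw [sub_zero] at h1
    refine h1.trans ?_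
    rw [pow_two, ← mul_assoc]
    exact mul_le_mul_of_nonneg_left hy (by positivity)
  intro y hy
  refine ⟨?_, hG y hy, by rw [toEuclideanCLM_taylorModel_B]; exact hH y hy⟩
  have hE : ∀ z ∈ {y : EuclideanSpace ℝ (Fin n) | ‖y‖ ≤ Δ},
      HasFDerivWithinAt (fun z => F z - (taylorModel h0).eval z)
        (innerSL ℝ (gradient F z - gradient (taylorModel h0).eval z)) {y | ‖y‖ ≤ Δ} z := by
    intro z hz
    have h1 := (hF.1 z hz).1.self_of_nhds.hasGradientAt.hasFDerivAt
    have h2 := ((taylorModel h0).hasGradientAt_eval z).differentiableAt.hasGradientAt.hasFDerivAt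
    rw [map_sub]
    exact (h1.sub h2).hasFDerivWithinAt
  have h3 := hconv.norm_image_sub_le_of_norm_hasFDerivWithin_le hE
    (fun z hz => by rw [innerSL_apply_norm]; exact hG z hz) hmem hy
  have h4 : (taylorModel h0).eval 0 = F 0 := by simp [QuadModel.eval_eq_inner, taylorModel]
  rw [h4, sub_self, sub_zero, sub_zero, Real.norm_eq_abs] at h3
  refine h3.trans ?_
  rw [pow_succ Δ 2, ← mul_assoc]
  exact mul_le_mul_of_nonneg_left hy (by positivity)

/-- A quadratic interpolant of a function with Lipschitz Hessian at a `Λ`-poised set is a fully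
quadratic model. -/
theorem IsLambdaPoised.isFullyQuadratic {F : EuclideanSpace ℝ (Fin n) → ℝ} {L Λ Δ : ℝ}
    (hL : 0 ≤ L) (hΔ : 0 < Δ) (hF : HasLipschitzHessianOn F {y | ‖y‖ ≤ Δ} L)
    {Y : Fin (quadDim n) → EuclideanSpace ℝ (Fin n)} (hY : IsLambdaPoised Λ Δ Y)
    (hball : ∀ i, ‖Y i‖ ≤ Δ) {m : QuadModel n} (hm : Interpolates m F Y) :
    IsFullyQuadratic F m Δ (L + quadDim n * (L * Λ)) (L + 5 * (quadDim n * (L * Λ)))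
      (L + 4 * (quadDim n * (L * Λ))) := by
  have h0 : TwiceDifferentiableAt F 0 := hF.1 0 (by simpa using hΔ.le)
  have hP := isFullyQuadratic_taylorModel hL hΔ hF h0
  set P := taylorModel h0
  set K := (quadDim n : ℝ) * (L * Λ) with hK
  have hq : ∀ y, ‖y‖ ≤ Δ → |(P.sub m).eval y| ≤ K * Δ ^ 3 := by
    intro y hy
    refine (hY.abs_eval_le (ε := L * Δ ^ 3) (by positivity) (fun i => ?_) hy).trans_eq
      (by rw [hK]; ring)
    rw [QuadModel.eval_sub, hm i, abs_sub_comm]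
    exact (hP _ (hball i)).1
  have hg : ‖(P.sub m).g‖ ≤ K * Δ ^ 2 := by
    refine le_of_mul_le_mul_right ((QuadModel.norm_g_mul_le hΔ hq).trans_eq ?_) hΔ
    ring
  have hB : ‖Matrix.toEuclideanCLM (𝕜 := ℝ) (P.sub m).B‖ ≤ 4 * K * Δ := by
    refine le_of_mul_le_mul_right ((QuadModel.norm_B_mul_le hΔ hq).trans_eq ?_) (pow_pos hΔ 2)
    ring
  have hBsub : Matrix.toEuclideanCLM (𝕜 := ℝ) (P.sub m).B
      = Matrix.toEuclideanCLM (𝕜 := ℝ) P.B - Matrix.toEuclideanCLM (𝕜 := ℝ) m.B := map_sub _ _ _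
  intro y hy
  obtain ⟨h1, h2, h3⟩ := hP y hy
  refine ⟨?_, ?_, ?_⟩
  · have h := hq y hy
    rw [QuadModel.eval_sub] at h
    have := abs_sub_le (F y) (P.eval y) (m.eval y)
    linarith
  · have hgrad : gradient P.eval y - gradient m.eval y
        = (P.sub m).g + Matrix.toEuclideanCLM (𝕜 := ℝ) (P.sub m).B y := by
      rw [(P.hasGradientAt_eval y).gradient, (m.hasGradientAt_eval y).gradient, hBsub,
        add_sub_add_comm]
      rfl
    have h4 : ‖gradient P.eval y - gradient m.eval y‖ ≤ K * Δ ^ 2 + 4 * K * Δ * Δ := by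
      rw [hgrad]
      refine (norm_add_le _ _).trans (add_le_add hg ?_)
      refine (ContinuousLinearMap.le_opNorm _ _).trans ?_
      exact mul_le_mul hB hy (norm_nonneg _) ((norm_nonneg _).trans hB)
    have := norm_sub_le_norm_sub_add_norm_sub (gradient F y) (gradient P.eval y)
      (gradient m.eval y)
    linarith
  · rw [hBsub] at hB
    have := norm_sub_le_norm_sub_add_norm_sub (hess F y) (Matrix.toEuclideanCLM (𝕜 := ℝ) P.B)
      (Matrix.toEuclideanCLM (𝕜 := ℝ) m.B)
    linarith

theorem norm_toInduced_le_of_mem_metricBall {M : Matrix (Fin n) (Fin n) ℝ} (hM : M.PosSemidef)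
    {x z : EuclideanSpace ℝ (Fin n)} {Δ : ℝ} (hz : z ∈ metricBall M x Δ) :
    ‖toInduced M (z - x)‖ ≤ Δ := by
  rw [← Real.sqrt_sq (norm_nonneg _), sq_norm_toInduced hM]
  exact hz

theorem mainTheorem10 :
    ∃ κf κg κH : ℕ → ℝ → ℝ → ℝ,
      ∀ (n : ℕ) (f : EuclideanSpace ℝ (Fin n) → ℝ) (R : Set (EuclideanSpace ℝ (Fin n)))
        (L₂ mmin mmax : ℝ)
        (x : ℕ → EuclideanSpace ℝ (Fin n)) (Δ : ℕ → ℝ) (M : ℕ → Matrix (Fin n) (Fin n) ℝ),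
        0 ≤ L₂ → 0 < mmin → mmin ≤ mmax → (∀ k, 0 < Δ k) →
        (∀ k, (M k - mmin • (1 : Matrix (Fin n) (Fin n) ℝ)).PosSemidef ∧
          (mmax • (1 : Matrix (Fin n) (Fin n) ℝ) - M k).PosSemidef) →
        (∀ k y, ‖y‖ ≤ Δ k → x k + fromInduced (M k) y ∈ R) →
        HasLipschitzHessianOn f R L₂ →
        (∀ k, HasLipschitzHessianOn (inducedFun f (x k) (M k)) {y | ‖y‖ ≤ Δ k}
          (L₂ * mmin ^ (-(3 / 2) : ℝ))) ∧
        ∀ (Λ : ℝ) (Y : ℕ → Fin (quadDim n) → EuclideanSpace ℝ (Fin n)) (m : ℕ → QuadModel n),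
          (∀ k, IsMetricPoised Λ (M k) (x k) (Δ k) (Y k)) →
          (∀ k, Interpolates (m k) (inducedFun f (x k) (M k))
            (fun i => toInduced (M k) (Y k i - x k))) →
          ∀ k, IsFullyQuadratic (inducedFun f (x k) (M k)) (m k) (Δ k)
            (κf n Λ (L₂ * mmin ^ (-(3 / 2) : ℝ)))
            (κg n Λ (L₂ * mmin ^ (-(3 / 2) : ℝ)))
            (κH n Λ (L₂ * mmin ^ (-(3 / 2) : ℝ))) := by
  refine ⟨fun n Λ L => L + quadDim n * (L * Λ), fun n Λ L => L + 5 * (quadDim n * (L * Λ)),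
    fun n Λ L => L + 4 * (quadDim n * (L * Λ)), ?_⟩
  intro n f R L₂ mmin mmax x Δ M hL hmin _ hΔ hM hR hf
  have hF : ∀ k, HasLipschitzHessianOn (inducedFun f (x k) (M k)) {y | ‖y‖ ≤ Δ k}
      (L₂ * mmin ^ (-(3 / 2) : ℝ)) := fun k =>
    hasLipschitzHessianOn_inducedFun hL hmin (hM k).1 (hR k) hf
  refine ⟨hF, fun Λ Y m hY hm k => ?_⟩
  have hMk := (posDef_of_sub_smul_one hmin (hM k).1).posSemidef
  exact (hY k).2.isFullyQuadratic (mul_nonneg hL (Real.rpow_nonneg hmin.le _)) (hΔ k) (hF k)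
    (fun i => norm_toInduced_le_of_mem_metricBall hMk ((hY k).1 i)) (hm k)
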